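/- Consider $N$ nodes in $\mathbb R^n$ (for instance $n=2$ or $n=3$), split into a finite set $\mathcal U$ of tags and a finite set $\mathcal K$ of anchors. Write $\mathbf p=\mathrm{col}(\mathbf p_{\mathcal U},\mathbf p_{\mathcal K})\in\mathbb R^{nN}$ for their positions, $\mathbf p_{ij}=\mathbf p_i-\mathbf p_j$ and $d_{ij}=\|\mathbf p_{ij}\|$. Let $\mathcal P$ be a finite set of unordered pairs of distinct nodes (the ranging pairs), each containing at least one tag. For $\{i,j\}\in\mathcal P$ a measurement $\tilde d_{ij}$ of $d_{ij}$ is available, and either all measurements have additive Gaussian noise, $\tilde d_{ij}=d_{ij}+\nu_{ij}$ (set $\kappa=1$), or all have multiplicative log-normal noise, $\tilde d_{ij}=d_{ij}e^{\nu_{ij}}$ (set $\kappa=2$), where the $\nu_{ij}$ are independent with law $\mathcal N(0,\sigma^2)$, $\sigma>0$. Let $\tilde{\mathbf d}\in\mathbb R^{\mathcal P}$ be the vector of all measurements. Let $\mathcal G$ be the graph on the nodes whose edges are the ranging pairs and all pairs of distinct anchors, let $\mathcal N_i$ be the set of neighbours of $i$ in $\mathcal G$, and let $\mathbf F(\mathbf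 p)$ be the $nN\times nN$ matrix with $n\times n$ blocks $$\mathbf F_{ij}=-\frac{1}{d_{ij}^{2\kappa}\sigma^2}\,\mathbf p_{ij}\mathbf p_{ij}^\top\,\mathsf 1_{\mathcal N_i}(j)\quad(i\ne j),\qquad \mathbf F_{ii}=-\sum_{j\neq i}\mathbf F_{ij}.$$ Let $\mathbf F_{\mathcal U}(\mathbf p)$ be its submatrix of size $n|\mathcal U|\times n|\mathcal U|$ whose rows and columns correspond to the tags. Let $\mathbf p=\mathrm{col}(\mathbf p_{\mathcal U},\mathbf p_{\mathcal K})$ be a configuration with $d_{ij}>0$ for every ranging pair $\{i,j\}$. Then: 1. $\mathbf F_{\mathcal U}(\mathbf p)$ is the tag block of the Fisher information matrix of the measurements, that is, of the matrix $-\mathbb E\big[\partial^2\ln f(\tilde{\mathbf d};\mathbf p)/\partial\mathbf p\,\partial\mathbf p^\top\big]$, where $f(\cdot;\mathbf p)$ is the probability density of $\tilde{\mathbf d}$. 2. Let $\hat{\mathbf p}_{\mathcal U}$ be an unbiased estimator of the tag positions based on the measurements $\tilde{\mathbf d}$ and the known anchor positions $\mathbf p_{\mathcal K}$: for the given $\mathbf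 p_{\mathcal K}$, a measurable function $\hat{\mathbf p}_{\mathcal U}=T(\tilde{\mathbf d})$, where $T$ does not depend on the unknown tag positions, such that $\mathbb E_{\mathbf q}[T(\tilde{\mathbf d})]=\mathbf q_{\mathcal U}$ for every configuration $\mathbf q=\mathrm{col}(\mathbf q_{\mathcal U},\mathbf p_{\mathcal K})$ with $\mathbf q_{\mathcal U}$ in some neighbourhood of $\mathbf p_{\mathcal U}$ (in particular, this holds if $T$ is unbiased for all tag positions). If its covariance matrix at $\mathbf p$ is finite, then $$\mathsf{cov}[\hat{\mathbf p}_{\mathcal U}]\succeq \mathbf F_{\mathcal U}^\dagger(\mathbf p),$$ where $\dagger$ is the Moore–Penrose pseudo-inverse, the covariance is taken under the law of $\tilde{\mathbf d}$ at $\mathbf p$, and $\mathbf A\succeq\mathbf B$ means that $\mathbf A-\mathbf B$ is positive semidefinite. -/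

import Mathlib

open MeasureTheory ProbabilityTheory Filter Topology
open scoped NNReal ENNReal Matrix

noncomputable section

/-! ### The Moore–Penrose inverse of a real matrix -/

/-- `B` satisfies the four Penrose equations for `A`. -/
def IsMoorePenroseInverse {m n : Type*} [Fintype m] [Fintype n]
    (A : Matrix m n ℝ) (B : Matrix n m ℝ) : Prop :=
  A * B * A = A ∧ B * A * B = B ∧ (A * B)ᵀ = A * B ∧ (B * A)ᵀ = B * A

theorem IsMoorePenroseInverse.unique {m n : Type*} [Fintype m] [Fintype n]
    {A : Matrix m n ℝ} {B C : Matrix n m ℝ}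
    (hB : IsMoorePenroseInverse A B) (hC : IsMoorePenroseInverse A C) : B = C := by
  obtain ⟨b1, b2, b3, b4⟩ := hB
  obtain ⟨c1, c2, c3, c4⟩ := hC
  have h1 : A * B = A * C := by
    calc A * B = (A * C * A) * B := by rw [c1]
      _ = (A * C) * (A * B) := by simp only [Matrix.mul_assoc]
      _ = (A * C)ᵀ * (A * B)ᵀ := by rw [c3, b3]
      _ = ((A * B * A) * C)ᵀ := by rw [← Matrix.transpose_mul]; simp only [Matrix.mul_assoc]
      _ = A * C := by rw [b1, c3]
  have h2 : B * A = C * A := by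
    calc B * A = B * (A * C * A) := by rw [c1]
      _ = (B * A) * (C * A) := by simp only [Matrix.mul_assoc]
      _ = (B * A)ᵀ * (C * A)ᵀ := by rw [c4, b4]
      _ = (C * (A * B * A))ᵀ := by rw [← Matrix.transpose_mul]; simp only [Matrix.mul_assoc]
      _ = C * A := by rw [b1, c4]
  calc B = B * A * B := b2.symm
    _ = C * (A * B) := by rw [h2, Matrix.mul_assoc]
    _ = C := by rw [h1, ← Matrix.mul_assoc, c2]

theorem exists_isMoorePenroseInverse {m n : Type*} [Fintype m] [Fintype n]
    (A : Matrix m n ℝ) : ∃ B, IsMoorePenroseInverse A B := by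
  classical
  -- a symmetric matrix has a symmetric pseudo-inverse commuting with it
  have key : ∀ S : Matrix n n ℝ, S.IsHermitian →
      ∃ T : Matrix n n ℝ, Tᵀ = T ∧ S * T * S = S ∧ T * S * T = T ∧ T * S = S * T := by
    intro S hS
    set V : Matrix n n ℝ := (hS.eigenvectorUnitary : Matrix n n ℝ) with hV
    set d : n → ℝ := hS.eigenvalues with hd
    have hVV : Vᵀ * V = 1 := by
      have := Unitary.coe_star_mul_self hS.eigenvectorUnitary
      simpa [Matrix.star_eq_conjTranspose] using this
    have hSd : S = V * Matrix.diagonal d * Vᵀ := by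
      have := hS.spectral_theorem
      rw [Unitary.conjStarAlgAut_apply] at this
      simpa [Matrix.star_eq_conjTranspose, Function.comp_def] using this
    have hmul : ∀ x y : n → ℝ, (V * Matrix.diagonal x * Vᵀ) * (V * Matrix.diagonal y * Vᵀ)
        = V * Matrix.diagonal (fun i => x i * y i) * Vᵀ := by
      intro x y
      calc (V * Matrix.diagonal x * Vᵀ) * (V * Matrix.diagonal y * Vᵀ)
          = V * Matrix.diagonal x * (Vᵀ * V) * Matrix.diagonal y * Vᵀ := by
            simp only [Matrix.mul_assoc]
        _ = _ := by
            rw [hVV, Matrix.mul_one, Matrix.mul_assoc V, Matrix.diagonal_mul_diagonal]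
    refine ⟨V * Matrix.diagonal (fun i => (d i)⁻¹) * Vᵀ, ?_, ?_, ?_, ?_⟩
    · simp [Matrix.transpose_mul, Matrix.mul_assoc]
    · rw [hSd, hmul, hmul]
      simp [mul_inv_mul_cancel]
    · rw [hSd, hmul, hmul]
      congr 3
      funext i
      by_cases h : d i = 0 <;> simp [h]
    · rw [hSd, hmul, hmul]
      simp [mul_comm]
  obtain ⟨T, t1, t2, t3, t4⟩ := key (Aᵀ * A) (by
    have := Matrix.isHermitian_conjTranspose_mul_self A
    simpa using this)
  have h0 : A * (T * (Aᵀ * A)) = A := by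
    have : (A * (T * (Aᵀ * A)) - A)ᴴ * (A * (T * (Aᵀ * A)) - A) = 0 := by
      have e1 : (A * (T * (Aᵀ * A)) - A)ᴴ = (Aᵀ * A) * T * Aᵀ - Aᵀ := by
        simp [Matrix.conjTranspose_eq_transpose_of_trivial, Matrix.transpose_mul, t1,
          Matrix.mul_assoc]
      rw [e1]
      have e2 : ((Aᵀ * A) * T * Aᵀ - Aᵀ) * (A * (T * (Aᵀ * A)) - A)
          = ((Aᵀ * A) * T * (Aᵀ * A)) * T * (Aᵀ * A) - (Aᵀ * A) * T * (Aᵀ * A)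
            - ((Aᵀ * A) * T * (Aᵀ * A) - Aᵀ * A) := by
        simp only [Matrix.sub_mul, Matrix.mul_sub, Matrix.mul_assoc]
      rw [e2, t2, t2]; simp
    exact sub_eq_zero.mp (Matrix.conjTranspose_mul_self_eq_zero.mp this)
  refine ⟨T * Aᵀ, ?_, ?_, ?_, ?_⟩
  · rw [Matrix.mul_assoc, Matrix.mul_assoc T]; exact h0
  · calc T * Aᵀ * A * (T * Aᵀ) = (T * (Aᵀ * A) * T) * Aᵀ := by simp only [Matrix.mul_assoc]
      _ = T * Aᵀ := by rw [t3]
  · simp [Matrix.transpose_mul, t1, Matrix.mul_assoc]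
  · rw [Matrix.mul_assoc, t4]
    simp [Matrix.transpose_mul, t1, t4, Matrix.mul_assoc]

/-- The Moore–Penrose inverse `A†`, the unique solution of the four Penrose equations. -/
def moorePenrose {m n : Type*} [Fintype m] [Fintype n] (A : Matrix m n ℝ) : Matrix n m ℝ :=
  Classical.choose (exists_isMoorePenroseInverse A)

theorem isMoorePenroseInverse_moorePenrose {m n : Type*} [Fintype m] [Fintype n]
    (A : Matrix m n ℝ) : IsMoorePenroseInverse A (moorePenrose A) :=
  Classical.choose_spec (exists_isMoorePenroseInverse A)

/-! ### Fisher information and estimators -/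

/-- The Fisher information matrix at `x` of a family of densities `f y x` (observation `y`,
parameter `x`) with respect to Lebesgue measure:
`-𝔼[∂² ln f(y; x) / ∂xᵢ ∂xⱼ]`, the expectation being over `y` with density `f(·; x)`. -/
def fisherInformation {ι κ : Type*} [Fintype ι] [DecidableEq κ]
    (f : (ι → ℝ) → (κ → ℝ) → ℝ) (x : κ → ℝ) : Matrix κ κ ℝ :=
  Matrix.of fun i j => -∫ y : ι → ℝ,
    f y x * lineDeriv ℝ (fun x' => lineDeriv ℝ (fun x'' => Real.log (f y x'')) x' (Pi.single j 1))
      x (Pi.single i 1)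

/-- The estimator `T` has mean `q` when the observation has law `P`. -/
def HasMean {Y κ : Type*} [MeasurableSpace Y] (T : Y → κ → ℝ) (P : Measure Y) (q : κ → ℝ) :
    Prop :=
  ∀ a, Integrable (fun y => T y a) P ∧ ∫ y, T y a ∂P = q a

/-- The covariance matrix of `T` when the observation has law `P`. -/
def covarianceMatrix {Y κ : Type*} [MeasurableSpace Y] (T : Y → κ → ℝ) (P : Measure Y) :
    Matrix κ κ ℝ :=
  Matrix.of fun a b => covariance (fun y => T y a) (fun y => T y b) P

/-! ### Ranging networks

The nodes are `U ⊕ K`, with `U` the tags and `K` the anchors; a configuration is a vector indexed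
by a node and one of `n` coordinates. -/

/-- The configuration `col(p_U, p_K)`. -/
def configuration {n : ℕ} {U K : Type*} (pU : U × Fin n → ℝ) (pK : K × Fin n → ℝ) :
    (U ⊕ K) × Fin n → ℝ :=
  fun x => Sum.elim (fun u => pU (u, x.2)) (fun k => pK (k, x.2)) x.1

/-- The vector `p_ij = p_i - p_j`. -/
def relPos {n : ℕ} {V : Type*} (p : V × Fin n → ℝ) (i j : V) : Fin n → ℝ :=
  fun k => p (i, k) - p (j, k)

/-- The Euclidean distance `d_ij` between two nodes. -/
def nodeDist {n : ℕ} {V : Type*} (p : V × Fin n → ℝ) (i j : V) : ℝ :=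
  √(∑ k, relPos p i j k ^ 2)

/-- The distance `d_ij` as a function of the unordered pair `{i, j}`. -/
def pairDist {n : ℕ} {V : Type*} (p : V × Fin n → ℝ) : Sym2 V → ℝ :=
  Sym2.lift ⟨nodeDist p, fun i j => by
    simp only [nodeDist, relPos]
    congr 1
    exact Finset.sum_congr rfl fun k _ => by ring⟩

/-- The ranging graph: an edge for each ranging pair and for each pair of anchors. -/
def rangingGraph {U K : Type*} (E : Finset (Sym2 (U ⊕ K))) : SimpleGraph (U ⊕ K) where
  Adj i j := i ≠ j ∧ (s(i, j) ∈ E ∨ (i.isRight ∧ j.isRight))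
  symm := ⟨fun i j h => ⟨h.1.symm, by rw [Sym2.eq_swap]; tauto⟩⟩
  loopless := ⟨fun _ h => h.1 rfl⟩

/-- The two measurement models: additive Gaussian noise `d + ν`, and multiplicative log-normal
noise `d * exp μ`. -/
inductive NoiseModel
  | additive
  | multiplicative

/-- The measurement of a distance `d` with noise realization `w`. -/
def NoiseModel.observe : NoiseModel → ℝ → ℝ → ℝ
  | .additive, d, w => d + w
  | .multiplicative, d, w => d * Real.exp w

/-- The exponent `κ` of the model. -/
def NoiseModel.kappa : NoiseModel → ℕ
  | .additive => 1
  | .multiplicative => 2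

/-- The density at `y` of one measurement of a distance `d`, with noise of variance `σ ^ 2`. -/
def NoiseModel.density : NoiseModel → ℝ≥0 → ℝ → ℝ → ℝ
  | .additive, σ, d, y => gaussianPDFReal d (σ ^ 2) y
  | .multiplicative, σ, d, y =>
      if 0 < y then gaussianPDFReal (Real.log d) (σ ^ 2) (Real.log y) / y else 0

/-- The law of the vector of all measurements `d̃_e`, `e ∈ E`, in the configuration `p`: the noises
are independent with law `N(0, σ²)`. -/
def measurementLaw {n : ℕ} {V : Type*} (E : Finset (Sym2 V)) (M : NoiseModel) (σ : ℝ≥0)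
    (p : V × Fin n → ℝ) : Measure (E → ℝ) :=
  (Measure.pi fun _ : E => gaussianReal 0 (σ ^ 2)).map
    fun w e => M.observe (pairDist p e) (w e)

/-- The probability density `f(d̃; p)` of the vector of all measurements. -/
def measurementDensity {n : ℕ} {V : Type*} (E : Finset (Sym2 V)) (M : NoiseModel) (σ : ℝ≥0)
    (y : E → ℝ) (p : V × Fin n → ℝ) : ℝ :=
  ∏ e : E, M.density σ (pairDist p e) (y e)

theorem NoiseModel.density_nonneg (M : NoiseModel) (σ : ℝ≥0) (d y : ℝ) : 0 ≤ M.density σ d y := by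
  cases M
  · exact gaussianPDFReal_nonneg _ _ _
  · simp only [NoiseModel.density]
    split_ifs with h
    · exact div_nonneg (gaussianPDFReal_nonneg _ _ _) h.le
    · exact le_rfl

theorem NoiseModel.measurable_density (M : NoiseModel) (σ : ℝ≥0) (d : ℝ) :
    Measurable (M.density σ d) := by
  cases M
  · exact measurable_gaussianPDFReal _ _
  · refine Measurable.ite measurableSet_Ioi ?_ measurable_const
    exact ((measurable_gaussianPDFReal _ _).comp Real.measurable_log).div measurable_id

theorem NoiseModel.measurable_observe (M : NoiseModel) (d : ℝ) : Measurable (M.observe d) := by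
  cases M
  · exact measurable_const.add measurable_id
  · exact measurable_const.mul Real.measurable_exp

/-- `NoiseModel.density` is the density of a single measurement. -/
theorem NoiseModel.map_observe (M : NoiseModel) {σ : ℝ≥0} (hσ : 0 < σ) {d : ℝ} (hd : 0 < d) :
    (gaussianReal 0 (σ ^ 2)).map (M.observe d) =
      volume.withDensity fun y => ENNReal.ofReal (M.density σ d y) := by
  have hv : σ ^ 2 ≠ 0 := pow_ne_zero _ hσ.ne'
  cases M
  · change (gaussianReal 0 (σ ^ 2)).map (fun w => d + w) = _
    rw [gaussianReal_map_const_add, zero_add, gaussianReal_of_var_ne_zero _ hv]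
    rfl
  · have h1 : NoiseModel.multiplicative.observe d = Real.exp ∘ fun w => Real.log d + w := by
      funext w
      simp [NoiseModel.observe, Real.exp_add, Real.exp_log hd]
    rw [h1, ← Measure.map_map Real.measurable_exp (by fun_prop), gaussianReal_map_const_add,
      zero_add, gaussianReal_of_var_ne_zero _ hv]
    ext s hs
    have hA : MeasurableSet (Real.exp ⁻¹' s) := Real.measurable_exp hs
    rw [Measure.map_apply Real.measurable_exp hs, withDensity_apply _ hA, withDensity_apply _ hs]
    have him : Real.exp '' (Real.exp ⁻¹' s) = s ∩ Set.Ioi 0 := by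
      rw [Set.image_preimage_eq_inter_range, Real.range_exp]
    have h2 := lintegral_image_eq_lintegral_abs_deriv_mul hA
      (fun x _ => (Real.hasDerivAt_exp x).hasDerivWithinAt) Real.exp_injective.injOn
      (fun y => ENNReal.ofReal (NoiseModel.multiplicative.density σ d y))
    rw [him] at h2
    have h3 : ∫⁻ y in s, ENNReal.ofReal (NoiseModel.multiplicative.density σ d y) =
        ∫⁻ y in s ∩ Set.Ioi 0, ENNReal.ofReal (NoiseModel.multiplicative.density σ d y) := by
      rw [← lintegral_indicator hs, ← lintegral_indicator (hs.inter measurableSet_Ioi)]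
      congr 1
      funext y
      by_cases hy : 0 < y <;> by_cases hys : y ∈ s <;>
        simp [Set.indicator, hy, hys, NoiseModel.density]
    rw [h3, h2]
    congr 1
    funext x
    rw [← ENNReal.ofReal_mul (abs_nonneg _)]
    have hx := Real.exp_pos x
    simp only [NoiseModel.density, hx, if_true, Real.log_exp, abs_of_pos, gaussianPDF]
    rw [mul_div_cancel₀ _ hx.ne']

/-- `measurementDensity` is the density of the vector of all measurements. -/
theorem measurementLaw_eq_withDensity {n : ℕ} {V : Type*} (E : Finset (Sym2 V)) (M : NoiseModel)
    {σ : ℝ≥0} (hσ : 0 < σ) (p : V × Fin n → ℝ) (hp : ∀ e ∈ E, 0 < pairDist p e) :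
    measurementLaw E M σ p =
      volume.withDensity fun y => ENNReal.ofReal (measurementDensity E M σ y p) := by
  have hf : ∀ e : E, (gaussianReal 0 (σ ^ 2)).map (M.observe (pairDist p e)) =
      volume.withDensity fun y => ENNReal.ofReal (M.density σ (pairDist p e) y) :=
    fun e => M.map_observe hσ (hp e e.2)
  have hint : ∀ e : E, Integrable (M.density σ (pairDist p e)) := by
    intro e
    have h1 : IsProbabilityMeasure ((gaussianReal 0 (σ ^ 2)).map (M.observe (pairDist p e))) :=
      Measure.isProbabilityMeasure_map (M.measurable_observe _).aemeasurable
    refine ⟨(M.measurable_density σ _).aestronglyMeasurable, ?_⟩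
    rw [hasFiniteIntegral_iff_ofReal (Eventually.of_forall fun y => M.density_nonneg σ _ y)]
    have h2 := h1.measure_univ
    rw [hf e, withDensity_apply _ MeasurableSet.univ, Measure.restrict_univ] at h2
    rw [h2]
    exact ENNReal.one_lt_top
  have : ∀ e : E, SigmaFinite ((gaussianReal 0 (σ ^ 2)).map (M.observe (pairDist p e))) := by
    intro e
    have := Measure.isProbabilityMeasure_map (μ := gaussianReal 0 (σ ^ 2))
      (M.measurable_observe (pairDist p e)).aemeasurable
    infer_instance
  rw [measurementLaw, Measure.pi_map_pi fun e => (M.measurable_observe _).aemeasurable]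
  refine Measure.pi_eq fun s hs => ?_
  rw [withDensity_apply _ (MeasurableSet.univ_pi hs), volume_pi, Measure.restrict_pi_pi]
  simp only [measurementDensity]
  rw [← ofReal_integral_eq_lintegral_ofReal
      (Integrable.fintype_prod fun e => (hint e).restrict)
      (Eventually.of_forall fun y => Finset.prod_nonneg fun e _ => M.density_nonneg σ _ _),
    integral_fintype_prod_eq_prod (fun (e : E) y => M.density σ (pairDist p e) y),
    ENNReal.ofReal_prod_of_nonneg fun e _ => integral_nonneg fun y => M.density_nonneg σ _ y]
  refine Finset.prod_congr rfl fun e _ => ?_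
  rw [hf e, withDensity_apply _ (hs e),
    ofReal_integral_eq_lintegral_ofReal (hint e).restrict
      (Eventually.of_forall fun y => M.density_nonneg σ _ y)]

open Classical in
/-- The block `F_ij`, `i ≠ j`, of the network Fisher information matrix. -/
def networkFIMOffDiag {n : ℕ} {V : Type*} (G : SimpleGraph V) (M : NoiseModel) (σ : ℝ≥0)
    (p : V × Fin n → ℝ) (i j : V) : Matrix (Fin n) (Fin n) ℝ :=
  if G.Adj i j then
    -((1 / (nodeDist p i j ^ (2 * M.kappa) * (σ : ℝ) ^ 2)) •
      Matrix.vecMulVec (relPos p i j) (relPos p i j))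
  else 0

open Classical in
/-- The network Fisher information matrix `F(p)`, with `F_ij` off the diagonal and
`F_ii = -∑_{j ≠ i} F_ij`. -/
def networkFIM {n : ℕ} {V : Type*} [Fintype V] (G : SimpleGraph V) (M : NoiseModel) (σ : ℝ≥0)
    (p : V × Fin n → ℝ) : Matrix (V × Fin n) (V × Fin n) ℝ :=
  Matrix.of fun a b =>
    if a.1 = b.1 then
      (-∑ j ∈ Finset.univ.erase a.1, networkFIMOffDiag G M σ p a.1 j) a.2 b.2
    else networkFIMOffDiag G M σ p a.1 b.1 a.2 b.2

/-- The block of a matrix that corresponds to the tags. -/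
def tagBlock {n : ℕ} {U K : Type*}
    (F : Matrix ((U ⊕ K) × Fin n) ((U ⊕ K) × Fin n) ℝ) : Matrix (U × Fin n) (U × Fin n) ℝ :=
  F.submatrix (fun a => (Sum.inl a.1, a.2)) (fun a => (Sum.inl a.1, a.2))

end

noncomputable section

/-! ### The Chapman–Robbins inequality -/

/-! Put `g_e(p) = location (d_e)`, with `location` the identity or the logarithm. In this coordinate
every measurement is `g_e(p)` plus centred Gaussian noise of variance `σ²`, so both noise models are
Gaussian location families. Let `J` be the Jacobian of `g`.

Fisher matrix: up to a term free of `p`, the log-density is `-∑ (location y_e - g_e(p))² / (2σ²)`.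
Its Hessian is a residual times the Hessian of `g_e`, minus a product of gradients of `g_e`. The
residual has mean zero, which leaves `σ⁻² JᵀJ` (`fisherInformation_measurementDensity`). The row of
`J` for a pair `{i, j}` is `±p_ij / d_ij^κ` on the blocks of `i` and `j` and zero elsewhere, so the
tag block of `σ⁻² JᵀJ` is `F_U` (`tagBlock_networkFIM`).

Covariance bound: `T` is only measurable and square integrable, so differentiation under the
integral is replaced by Chapman–Robbins. Moving the tags by `t w` translates the Gaussian noise by
some `δ`, and the likelihood ratio has second moment `exp(|δ|²/σ²)`. Cauchy–Schwarz for the ratio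
and `x ⬝ T` gives `(t x⬝w)² ≤ Var(x⬝T) (exp(|δ|²/σ²) - 1)`. Dividing by `t²` and letting `t → 0`
gives `(x⬝w)² ≤ (xᵀCx)(wᵀF_U w)`, with `C` the covariance matrix (`sq_dotProduct_le_variance_mul`).
The choice `w = F_U† x` concludes (`posSemidef_sub_moorePenrose`). -/

/-- The Cauchy–Schwarz inequality for the covariance. -/
theorem covariance_sq_le_variance_mul_variance {Ω : Type*} [MeasurableSpace Ω] {P : Measure Ω}
    [IsProbabilityMeasure P] {X Y : Ω → ℝ} (hX : MemLp X 2 P) (hY : MemLp Y 2 P) :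
    covariance X Y P ^ 2 ≤ variance X P * variance Y P := by
  -- The quadratic is the variance of `X + t • Y`; being nonnegative, it has nonpositive
  -- discriminant.
  have h : ∀ t : ℝ, 0 ≤ variance Y P * (t * t) + 2 * covariance X Y P * t + variance X P := by
    intro t
    have h1 : variance (X + t • Y) P = _ := variance_add hX (hY.const_smul t)
    rw [covariance_smul_right, variance_smul] at h1
    have h2 := variance_nonneg (X + t • Y) P
    rw [h1] at h2
    linarith
  have := discrim_le_zero h
  rw [discrim] at this
  linarith

/-- The Chapman–Robbins inequality. -/
theorem sq_integral_sub_le_of_withDensity {Ω : Type*} [MeasurableSpace Ω] {P : Measure Ω}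
    [IsProbabilityMeasure P] {X L : Ω → ℝ} (hX : MemLp X 2 P) (hL : MemLp L 2 P)
    (hLm : Measurable L) (hL0 : ∀ w, 0 ≤ L w) (hL1 : ∫ w, L w ∂P = 1) :
    (∫ w, X w ∂(P.withDensity fun w => ENNReal.ofReal (L w)) - ∫ w, X w ∂P) ^ 2 ≤
      variance X P * (∫ w, L w ^ 2 ∂P - 1) := by
  -- Since `L` has mean 1, the difference of the means is `E[XL] - E[X]E[L]`, the covariance of `X`
  -- and `L`, and the last factor of the bound is the variance of `L`.
  have h1 : ∫ w, X w ∂(P.withDensity fun w => ENNReal.ofReal (L w)) = ∫ w, (X * L) w ∂P := by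
    rw [integral_withDensity_eq_integral_toReal_smul (by fun_prop) (by simp)]
    refine integral_congr_ae (Eventually.of_forall fun w => ?_)
    simp [ENNReal.toReal_ofReal (hL0 w), mul_comm]
  have h2 := covariance_eq_sub hX hL
  have h3 := variance_eq_sub hL
  have h4 := covariance_sq_le_variance_mul_variance hX hL
  rw [hL1] at h2 h3
  rw [h2, h3] at h4
  rw [h1]
  simpa using h4

/-! ### Translation of a product of Gaussian measures -/

theorem gaussianReal_eq_withDensity {v : ℝ≥0} (hv : v ≠ 0) (d : ℝ) :
    gaussianReal d v = (gaussianReal 0 v).withDensity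
      fun x => ENNReal.ofReal (Real.exp (d * x / v - d ^ 2 / (2 * v))) := by
  rw [gaussianReal_of_var_ne_zero _ hv, gaussianReal_of_var_ne_zero _ hv,
    ← withDensity_mul _ (measurable_gaussianPDF _ _) (by fun_prop)]
  congr 1
  funext x
  have hv' : (v : ℝ) ≠ 0 := by exact_mod_cast hv
  simp only [Pi.mul_apply, gaussianPDF, gaussianPDFReal]
  rw [← ENNReal.ofReal_mul (by positivity), mul_assoc (√_)⁻¹, ← Real.exp_add]
  congr 3
  field_simp
  ring

/-- The density of a product of Gaussian measures with respect to the centred one. -/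
def gaussianShiftDensity {ι : Type*} [Fintype ι] (v : ℝ≥0) (d w : ι → ℝ) : ℝ :=
  ∏ e, Real.exp (d e * w e / v - d e ^ 2 / (2 * v))

theorem integral_exp_mul_gaussianReal {v : ℝ≥0} (t : ℝ) :
    ∫ x, Real.exp (t * x) ∂(gaussianReal 0 v) = Real.exp (v * t ^ 2 / 2) := by
  have := congrFun (mgf_id_gaussianReal (μ := 0) (v := v)) t
  simpa [mgf] using this

theorem integrable_exp_linear_gaussianReal {v : ℝ≥0} (t c : ℝ) :
    Integrable (fun x => Real.exp (t * x - c)) (gaussianReal 0 v) := by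
  simp only [Real.exp_sub]
  exact (integrable_exp_mul_gaussianReal t).div_const _

theorem integral_exp_linear_gaussianReal {v : ℝ≥0} (t c : ℝ) :
    ∫ x, Real.exp (t * x - c) ∂(gaussianReal 0 v) = Real.exp (v * t ^ 2 / 2 - c) := by
  simp only [Real.exp_sub]
  rw [integral_div, integral_exp_mul_gaussianReal]

section shift

variable {ι : Type*} [Fintype ι] {v : ℝ≥0} (d : ι → ℝ)

theorem measurable_gaussianShiftDensity : Measurable (gaussianShiftDensity v d) := by
  unfold gaussianShiftDensity
  fun_prop

theorem gaussianShiftDensity_nonneg (w : ι → ℝ) : 0 ≤ gaussianShiftDensity v d w :=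
  Finset.prod_nonneg fun _ _ => (Real.exp_pos _).le

theorem integral_gaussianShiftDensity (hv : v ≠ 0) :
    ∫ w, gaussianShiftDensity v d w ∂(Measure.pi fun _ : ι => gaussianReal 0 v) = 1 := by
  have hv' : (v : ℝ) ≠ 0 := by exact_mod_cast hv
  unfold gaussianShiftDensity
  rw [integral_fintype_prod_eq_prod
    (fun e x => Real.exp (d e * x / v - d e ^ 2 / (2 * v)))]
  refine Finset.prod_eq_one fun e _ => ?_
  simp only [mul_div_right_comm]
  rw [integral_exp_linear_gaussianReal, Real.exp_eq_one_iff]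
  field_simp
  ring

theorem sq_gaussianShiftDensity (w : ι → ℝ) : gaussianShiftDensity v d w ^ 2 =
    ∏ e, Real.exp (2 * d e / v * w e - d e ^ 2 / v) := by
  unfold gaussianShiftDensity
  rw [← Finset.prod_pow]
  refine Finset.prod_congr rfl fun e _ => ?_
  rw [← Real.exp_nat_mul]
  congr 1
  -- For `v = 0` every quotient is 0 by convention, so nondegeneracy is not needed here.
  by_cases hv : (v : ℝ) = 0
  · simp [hv]
  · field_simp
    push_cast
    ring

theorem memLp_gaussianShiftDensity :
    MemLp (gaussianShiftDensity v d) 2 (Measure.pi fun _ : ι => gaussianReal 0 v) := by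
  rw [memLp_two_iff_integrable_sq (measurable_gaussianShiftDensity d).aestronglyMeasurable]
  simp only [sq_gaussianShiftDensity]
  exact Integrable.fintype_prod (f := fun e x => Real.exp (2 * d e / v * x - d e ^ 2 / v))
    fun e => integrable_exp_linear_gaussianReal _ _

theorem integral_sq_gaussianShiftDensity (hv : v ≠ 0) :
    ∫ w, gaussianShiftDensity v d w ^ 2 ∂(Measure.pi fun _ : ι => gaussianReal 0 v) =
      Real.exp ((∑ e, d e ^ 2) / v) := by
  have hv' : (v : ℝ) ≠ 0 := by exact_mod_cast hv
  simp only [sq_gaussianShiftDensity]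
  rw [integral_fintype_prod_eq_prod (fun e x => Real.exp (2 * d e / v * x - d e ^ 2 / v)),
    Finset.sum_div, Real.exp_sum]
  refine Finset.prod_congr rfl fun e _ => ?_
  -- Each coordinate contributes the exponent `v (2d/v)² / 2 - d²/v = d²/v`.
  rw [integral_exp_linear_gaussianReal]
  congr 1
  field_simp
  ring

theorem pi_gaussianReal_map_add_eq_withDensity (hv : v ≠ 0) :
    (Measure.pi fun _ : ι => gaussianReal 0 v).map (fun w e => w e + d e) =
      (Measure.pi fun _ : ι => gaussianReal 0 v).withDensity
        fun w => ENNReal.ofReal (gaussianShiftDensity v d w) := by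
  have hmap : ∀ e, (gaussianReal 0 v).map (fun x => x + d e) = gaussianReal (d e) v := fun e => by
    rw [gaussianReal_map_add_const, zero_add]
  have : ∀ e, SigmaFinite ((gaussianReal 0 v).map (fun x => x + d e)) := fun e => by
    rw [hmap]; infer_instance
  rw [Measure.pi_map_pi (f := fun e x => x + d e) fun e => by fun_prop]
  have hi : ∀ e, Integrable (fun x => Real.exp (d e * x / v - d e ^ 2 / (2 * v)))
      (gaussianReal 0 v) := fun e => by
    simp only [mul_div_right_comm]
    exact integrable_exp_linear_gaussianReal _ _
  refine Measure.pi_eq fun s hs => ?_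
  rw [withDensity_apply _ (MeasurableSet.univ_pi hs), Measure.restrict_pi_pi]
  unfold gaussianShiftDensity
  rw [← ofReal_integral_eq_lintegral_ofReal
      (Integrable.fintype_prod
        (f := fun e x => Real.exp (d e * x / v - d e ^ 2 / (2 * v))) fun e => (hi e).restrict)
      (Eventually.of_forall fun y => Finset.prod_nonneg fun e _ => (Real.exp_pos _).le),
    integral_fintype_prod_eq_prod (fun e x => Real.exp (d e * x / v - d e ^ 2 / (2 * v))),
    ENNReal.ofReal_prod_of_nonneg fun e _ => integral_nonneg fun y => (Real.exp_pos _).le]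
  refine Finset.prod_congr rfl fun e _ => ?_
  rw [hmap e, gaussianReal_eq_withDensity hv (d e), withDensity_apply _ (hs e),
    ofReal_integral_eq_lintegral_ofReal (hi e).restrict
      (Eventually.of_forall fun y => (Real.exp_pos _).le)]

/-- The Chapman–Robbins inequality for the translates of a Gaussian product measure. -/
theorem sq_integral_shift_sub_le (hv : v ≠ 0) {X : (ι → ℝ) → ℝ}
    (hXm : Measurable X) (hX : MemLp X 2 (Measure.pi fun _ : ι => gaussianReal 0 v)) :
    (∫ w, X (fun e => w e + d e) ∂(Measure.pi fun _ : ι => gaussianReal 0 v) -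
        ∫ w, X w ∂(Measure.pi fun _ : ι => gaussianReal 0 v)) ^ 2 ≤
      variance X (Measure.pi fun _ : ι => gaussianReal 0 v) *
        (Real.exp ((∑ e, d e ^ 2) / v) - 1) := by
  have h := sq_integral_sub_le_of_withDensity hX (memLp_gaussianShiftDensity d)
    (measurable_gaussianShiftDensity d) (gaussianShiftDensity_nonneg d)
    (integral_gaussianShiftDensity d hv)
  rw [← pi_gaussianReal_map_add_eq_withDensity d hv, integral_sq_gaussianShiftDensity d hv,
    integral_map (by fun_prop : Measurable _).aemeasurable hXm.aestronglyMeasurable] at h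
  exact h

end shift

/-! ### The noise models as Gaussian location families -/

/-- The transformation that turns the model into a Gaussian location family. -/
def NoiseModel.location : NoiseModel → ℝ → ℝ
  | .additive, d => d
  | .multiplicative, d => Real.log d

/-- The factor of the density that does not depend on the distance. -/
def NoiseModel.weight : NoiseModel → ℝ≥0 → ℝ → ℝ
  | .additive, σ, _ => (√(2 * Real.pi * (σ : ℝ) ^ 2))⁻¹
  | .multiplicative, σ, y => if 0 < y then (√(2 * Real.pi * (σ : ℝ) ^ 2))⁻¹ / y else 0

namespace NoiseModel

variable (M : NoiseModel)

/-- The distance enters only through the Gaussian exponent; the Jacobian factor `1 / y` of the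
log-normal law goes into the weight and disappears on differentiating in the configuration. -/
theorem density_eq_weight_mul (σ : ℝ≥0) (d y : ℝ) :
    M.density σ d y =
      M.weight σ y * Real.exp (-(M.location y - M.location d) ^ 2 / (2 * (σ : ℝ) ^ 2)) := by
  cases M
  · simp [density, weight, location, gaussianPDFReal]
  · by_cases h : 0 < y
    · simp only [density, weight, location, gaussianPDFReal, h, if_true]
      push_cast
      ring
    · simp [density, weight, h]

theorem measurable_location : Measurable M.location := by
  cases M
  · exact measurable_id
  · exact Real.measurable_log

theorem location_observe {d : ℝ} (hd : 0 < d) (w : ℝ) :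
    M.location (M.observe d w) = M.location d + w := by
  cases M
  · rfl
  · simp [location, observe, Real.log_mul hd.ne' (Real.exp_pos w).ne']

/-- A change of distance amounts to a translation of the noise. This is what makes the likelihood
ratio explicit. -/
theorem observe_add_location_sub {d d' : ℝ} (hd : 0 < d) (hd' : 0 < d') (w : ℝ) :
    M.observe d (w + (M.location d' - M.location d)) = M.observe d' w := by
  cases M
  · simp only [observe, location]
    ring
  · simp only [observe, location]
    rw [Real.exp_add, Real.exp_sub, Real.exp_log hd, Real.exp_log hd']
    field_simp

theorem contDiffAt_location {d : ℝ} (hd : 0 < d) {k : WithTop ℕ∞} :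
    ContDiffAt ℝ k M.location d := by
  cases M
  · exact contDiffAt_id
  · exact Real.contDiffAt_log.2 hd.ne'

/-- The form `d / d ^ κ` covers both derivatives, `1` and `1 / d`; its numerator cancels against the
gradient `p_ij / d` of the distance. -/
theorem hasDerivAt_location {d : ℝ} (hd : 0 < d) :
    HasDerivAt M.location (d / d ^ M.kappa) d := by
  cases M
  · simp only [kappa, pow_one, div_self hd.ne']
    exact hasDerivAt_id d
  · have : d / d ^ 2 = d⁻¹ := by field_simp
    simp only [kappa, this]
    exact Real.hasDerivAt_log hd.ne'

end NoiseModel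

/-! ### Derivatives of the distances -/

section geometry

variable {n : ℕ} {V : Type*}

theorem pairDist_mk (p : V × Fin n → ℝ) (a b : V) : pairDist p s(a, b) = nodeDist p a b := rfl

theorem relPos_swap (p : V × Fin n → ℝ) (i j : V) (k : Fin n) :
    relPos p j i k = -relPos p i j k := by
  simp [relPos]

theorem nodeDist_swap (p : V × Fin n → ℝ) (i j : V) : nodeDist p j i = nodeDist p i j := by
  rw [← pairDist_mk, Sym2.eq_swap, pairDist_mk]

theorem continuous_pairDist (e : Sym2 V) :
    Continuous fun p : V × Fin n → ℝ => pairDist p e := by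
  induction e with
  | _ a b =>
    simp only [pairDist_mk, nodeDist, relPos]
    fun_prop

theorem hasLineDerivAt_location_nodeDist (M : NoiseModel) {p : V × Fin n → ℝ} {a b : V}
    (h : 0 < nodeDist p a b) (v : V × Fin n → ℝ) :
    HasLineDerivAt ℝ (fun x => M.location (nodeDist x a b))
      ((∑ k, relPos p a b k * relPos v a b k) / nodeDist p a b ^ M.kappa) p v := by
  have h0 : ∀ k, relPos p a b k = relPos (p + (0 : ℝ) • v) a b k := by simp
  have h1 : HasDerivAt (fun t : ℝ => ∑ k, relPos (p + t • v) a b k ^ 2)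
      (∑ k, 2 * relPos p a b k * relPos v a b k) 0 := by
    refine HasDerivAt.fun_sum fun k _ => ?_
    have h2 : HasDerivAt (fun t : ℝ => relPos (p + t • v) a b k) (relPos v a b k) 0 := by
      have : (fun t : ℝ => relPos (p + t • v) a b k) =
          fun t => relPos p a b k + t * relPos v a b k := by
        funext t
        simp only [relPos, Pi.add_apply, Pi.smul_apply, smul_eq_mul]
        ring
      rw [this]
      simpa using ((hasDerivAt_id (0 : ℝ)).mul_const (relPos v a b k)).const_add (relPos p a b k)
    have h3 := h2.fun_pow 2
    rw [← h0] at h3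
    refine h3.congr_deriv ?_
    push_cast
    ring
  have hpos : nodeDist (p + (0 : ℝ) • v) a b = nodeDist p a b := by simp
  have h4 : HasDerivAt (fun t : ℝ => nodeDist (p + t • v) a b)
      ((∑ k, 2 * relPos p a b k * relPos v a b k) / (2 * nodeDist p a b)) 0 := by
    have := h1.sqrt (by
      simp only [← h0]
      exact (Real.sqrt_pos.1 h).ne')
    simp only [← h0] at this
    exact this
  have h5 := HasDerivAt.comp (0 : ℝ) (by rw [hpos]; exact M.hasDerivAt_location h) h4
  unfold HasLineDerivAt
  refine h5.congr_deriv ?_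
  simp only [mul_assoc, ← Finset.mul_sum]
  field_simp

variable [Fintype V]

theorem contDiffAt_location_pairDist (M : NoiseModel) {p : V × Fin n → ℝ} {e : Sym2 V}
    (h : 0 < pairDist p e) {k : WithTop ℕ∞} :
    ContDiffAt ℝ k (fun x => M.location (pairDist x e)) p := by
  induction e with
  | _ a b =>
    refine ContDiffAt.comp (f := fun x => pairDist x s(a, b)) p (M.contDiffAt_location h) ?_
    have h1 : ContDiffAt ℝ k (fun x : V × Fin n → ℝ => ∑ k, relPos x a b k ^ 2) p := by
      unfold relPos
      fun_prop
    exact h1.sqrt (Real.sqrt_pos.1 h).ne'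

theorem fderiv_location_pairDist (M : NoiseModel) {p : V × Fin n → ℝ} {a b : V}
    (h : 0 < nodeDist p a b) (v : V × Fin n → ℝ) :
    fderiv ℝ (fun x => M.location (pairDist x s(a, b))) p v =
      (∑ k, relPos p a b k * relPos v a b k) / nodeDist p a b ^ M.kappa := by
  have h1 := (contDiffAt_location_pairDist M (e := s(a, b)) h (k := 1)).differentiableAt (by simp)
  exact (h1.hasFDerivAt.hasLineDerivAt v).unique (hasLineDerivAt_location_nodeDist M h v)

end geometry

/-! ### The Jacobian of the measurement map -/

section jacobian

variable {n : ℕ} {V : Type*}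

/-- The weight vanishes at nonpositive log-normal observations. The Fisher integrand is then 0,
whatever value the derivatives of `Real.log 0` take. -/
theorem measurementDensity_eq_zero {E : Finset (Sym2 V)} {M : NoiseModel} {σ : ℝ≥0} {y : E → ℝ}
    {e : E} (h : M.weight σ (y e) = 0) (p : V × Fin n → ℝ) :
    measurementDensity E M σ y p = 0 :=
  Finset.prod_eq_zero (Finset.mem_univ e) (by simp [M.density_eq_weight_mul, h])

theorem log_measurementDensity {E : Finset (Sym2 V)} {M : NoiseModel} {σ : ℝ≥0} {y : E → ℝ}
    (h : ∀ e : E, M.weight σ (y e) ≠ 0) (p : V × Fin n → ℝ) :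
    Real.log (measurementDensity E M σ y p) = ∑ e : E, (Real.log (M.weight σ (y e)) +
      -(M.location (y e) - M.location (pairDist p e)) ^ 2 / (2 * (σ : ℝ) ^ 2)) := by
  simp only [measurementDensity, M.density_eq_weight_mul]
  rw [Real.log_prod fun e _ => mul_ne_zero (h e) (Real.exp_pos _).ne']
  refine Finset.sum_congr rfl fun e _ => ?_
  rw [Real.log_mul (h e) (Real.exp_pos _).ne', Real.log_exp]

variable [Fintype V]

/-- The second derivative of `location ∘ pairDist` is left uncomputed: it multiplies the residual
and averages out. -/
theorem lineDeriv_lineDeriv_log_measurementDensity {E : Finset (Sym2 V)} {M : NoiseModel}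
    {σ : ℝ≥0} (hσ : 0 < σ) {y : E → ℝ} (h : ∀ e : E, M.weight σ (y e) ≠ 0) {p : V × Fin n → ℝ}
    (hp : ∀ e ∈ E, 0 < pairDist p e) (u v : V × Fin n → ℝ) :
    lineDeriv ℝ (fun x' => lineDeriv ℝ
      (fun x'' => Real.log (measurementDensity E M σ y x'')) x' v) p u =
      ∑ e : E, ((M.location (y e) - M.location (pairDist p e)) *
          lineDeriv ℝ (fun x => fderiv ℝ (fun x => M.location (pairDist x e)) x v) p u -
        fderiv ℝ (fun x => M.location (pairDist x e)) p u *
          fderiv ℝ (fun x => M.location (pairDist x e)) p v) / (σ : ℝ) ^ 2 := by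
  have hs : (σ : ℝ) ≠ 0 := by exact_mod_cast hσ.ne'
  have hC : ∀ e : E, ContDiffAt ℝ 2 (fun x => M.location (pairDist x e)) p :=
    fun e => contDiffAt_location_pairDist M (hp e e.2)
  -- The outer derivative requires the inner one on a neighbourhood of `p`, where the `C²` property
  -- persists.
  have hev : (fun x' => lineDeriv ℝ
      (fun x'' => Real.log (measurementDensity E M σ y x'')) x' v) =ᶠ[𝓝 p]
      fun x' => ∑ e : E, (M.location (y e) - M.location (pairDist x' e)) *
        fderiv ℝ (fun x => M.location (pairDist x e)) x' v / (σ : ℝ) ^ 2 := by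
    have : ∀ᶠ x' in 𝓝 p, ∀ e : E,
        ContDiffAt ℝ 2 (fun x => M.location (pairDist x e)) x' :=
      eventually_all.2 fun e => (hC e).eventually (by simp)
    filter_upwards [this] with x' hx'
    refine HasLineDerivAt.lineDeriv ?_
    simp only [log_measurementDensity h]
    unfold HasLineDerivAt
    refine HasDerivAt.fun_sum fun e _ => ?_
    have h1 := ((hx' e).differentiableAt (by simp)).hasFDerivAt.hasLineDerivAt v
    unfold HasLineDerivAt at h1
    have h2 := (((h1.const_sub (M.location (y e))).fun_pow 2).fun_neg.div_const
      (2 * (σ : ℝ) ^ 2)).const_add (Real.log (M.weight σ (y e)))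
    refine h2.congr_deriv ?_
    simp only [zero_smul, add_zero]
    field_simp
    push_cast
    ring
  rw [hev.lineDeriv_eq]
  refine HasLineDerivAt.lineDeriv ?_
  unfold HasLineDerivAt
  refine HasDerivAt.fun_sum fun e _ => ?_
  have h1 := ((hC e).differentiableAt (by simp)).hasFDerivAt.hasLineDerivAt u
  have h2 : LineDifferentiableAt ℝ
      (fun x => fderiv ℝ (fun x => M.location (pairDist x e)) x v) p u := by
    refine DifferentiableAt.lineDifferentiableAt ?_
    have h3 : DifferentiableAt ℝ (fderiv ℝ (fun x => M.location (pairDist x e))) p :=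
      ((hC e).fderiv_right (m := 1) (by norm_num)).differentiableAt (by simp)
    exact h3.clm_apply (differentiableAt_const v)
  have h3 := h2.hasLineDerivAt
  unfold HasLineDerivAt at h1 h3
  have h4 := ((h1.const_sub (M.location (y e))).mul h3).div_const ((σ : ℝ) ^ 2)
  refine h4.congr_deriv ?_
  simp only [zero_smul, add_zero]
  ring

variable [DecidableEq V]

/-- The Jacobian matrix of the location parameters of the measurements. -/
def rangingJacobian (E : Finset (Sym2 V)) (M : NoiseModel) (p : V × Fin n → ℝ) :
    Matrix E (V × Fin n) ℝ :=
  Matrix.of fun e a => fderiv ℝ (fun x => M.location (pairDist x e)) p (Pi.single a 1)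

theorem rangingJacobian_mulVec (E : Finset (Sym2 V)) (M : NoiseModel) (p v : V × Fin n → ℝ)
    (e : E) : (rangingJacobian E M p *ᵥ v) e =
      fderiv ℝ (fun x => M.location (pairDist x e)) p v := by
  conv_rhs => rw [← Finset.univ_sum_single v, map_sum]
  simp only [Matrix.mulVec, dotProduct, rangingJacobian, Matrix.of_apply]
  refine Finset.sum_congr rfl fun a _ => ?_
  have : (Pi.single a (v a) : V × Fin n → ℝ) = v a • Pi.single a 1 := by
    rw [← Pi.single_smul]; simp
  rw [this, map_smul, smul_eq_mul, mul_comm]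

theorem fisherInformation_measurementDensity {E : Finset (Sym2 V)} (M : NoiseModel)
    {σ : ℝ≥0} (hσ : 0 < σ) {p : V × Fin n → ℝ} (hp : ∀ e ∈ E, 0 < pairDist p e) :
    fisherInformation (measurementDensity E M σ) p =
      ((σ : ℝ) ^ 2)⁻¹ • ((rangingJacobian E M p)ᵀ * rangingJacobian E M p) := by
  ext i j
  set u : V × Fin n → ℝ := Pi.single i 1
  set v : V × Fin n → ℝ := Pi.single j 1
  set H : E → ℝ := fun e =>
    lineDeriv ℝ (fun x => fderiv ℝ (fun x => M.location (pairDist x e)) x v) p u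
  set D : (V × Fin n → ℝ) → E → ℝ := fun u e =>
    fderiv ℝ (fun x => M.location (pairDist x e)) p u
  -- `S` agrees with the second derivative of the log-density wherever the weights are nonzero, and
  -- is measurable on the whole space.
  set S : (E → ℝ) → ℝ := fun y => ∑ e : E,
    ((M.location (y e) - M.location (pairDist p e)) * H e - D u e * D v e) / (σ : ℝ) ^ 2
  have hSm : Measurable S := by
    have := M.measurable_location
    fun_prop
  have h1 : ∀ y : E → ℝ, measurementDensity E M σ y p * lineDeriv ℝ (fun x' => lineDeriv ℝ
      (fun x'' => Real.log (measurementDensity E M σ y x'')) x' v) p u =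
      (ENNReal.ofReal (measurementDensity E M σ y p)).toReal • S y := by
    intro y
    have h0 : 0 ≤ measurementDensity E M σ y p :=
      Finset.prod_nonneg fun e _ => M.density_nonneg _ _ _
    rw [ENNReal.toReal_ofReal h0, smul_eq_mul]
    by_cases h : ∀ e : E, M.weight σ (y e) ≠ 0
    · rw [lineDeriv_lineDeriv_log_measurementDensity hσ h hp]
    · push Not at h
      obtain ⟨e, he⟩ := h
      simp [measurementDensity_eq_zero he]
  have hfm : Measurable fun y : E → ℝ => ENNReal.ofReal (measurementDensity E M σ y p) := by
    have := fun e : E => M.measurable_density σ (pairDist p e)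
    unfold measurementDensity
    fun_prop
  have hom : Measurable fun (w : E → ℝ) (e : E) => M.observe (pairDist p e) (w e) := by
    have := fun e : E => M.measurable_observe (pairDist p e)
    fun_prop
  change -∫ y : E → ℝ, measurementDensity E M σ y p * lineDeriv ℝ (fun x' => lineDeriv ℝ
      (fun x'' => Real.log (measurementDensity E M σ y x'')) x' v) p u = _
  simp only [h1]
  rw [← integral_withDensity_eq_integral_toReal_smul hfm (by simp),
    ← measurementLaw_eq_withDensity E M hσ p hp, measurementLaw,
    integral_map hom.aemeasurable hSm.aestronglyMeasurable]
  have h2 : ∀ w : E → ℝ, S (fun e => M.observe (pairDist p e) (w e)) =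
      ∑ e : E, (w e * H e - D u e * D v e) / (σ : ℝ) ^ 2 := by
    intro w
    refine Finset.sum_congr rfl fun e _ => ?_
    rw [M.location_observe (hp e e.2), add_sub_cancel_left]
  simp only [h2]
  have hi : ∀ e : E, Integrable (fun w : E → ℝ => w e)
      (Measure.pi fun _ : E => gaussianReal 0 (σ ^ 2)) := fun e =>
    integrable_eval (memLp_one_iff_integrable.1 (memLp_id_gaussianReal 1))
  have hi' : ∀ e ∈ (Finset.univ : Finset E), Integrable
      (fun w : E → ℝ => (w e * H e - D u e * D v e) / (σ : ℝ) ^ 2)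
      (Measure.pi fun _ : E => gaussianReal 0 (σ ^ 2)) := fun e _ =>
    (((hi e).mul_const _).sub (integrable_const _)).div_const _
  rw [integral_finsetSum _ hi']
  -- The noise has mean zero, which removes `H e`.
  have h3 : ∀ e : E, ∫ w : E → ℝ, (w e * H e - D u e * D v e) / (σ : ℝ) ^ 2
      ∂(Measure.pi fun _ : E => gaussianReal 0 (σ ^ 2)) = -(D u e * D v e) / (σ : ℝ) ^ 2 := by
    intro e
    rw [integral_div, integral_sub ((hi e).mul_const _) (integrable_const _), integral_mul_const,
      integral_eval, integral_id_gaussianReal]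
    simp
  simp only [h3]
  rw [Matrix.smul_apply, Matrix.mul_apply, ← Finset.sum_neg_distrib, smul_eq_mul, Finset.mul_sum]
  refine Finset.sum_congr rfl fun e _ => ?_
  simp only [rangingJacobian, Matrix.transpose_apply, Matrix.of_apply, D, u, v]
  ring

end jacobian

/-! ### The network Fisher information matrix as a Gram matrix -/

section gram

variable {n : ℕ} {V : Type*} [Fintype V] [DecidableEq V]

theorem fderiv_location_pairDist_single (M : NoiseModel) {p : V × Fin n → ℝ} {i j : V}
    (hij : i ≠ j) (h : 0 < pairDist p s(i, j)) (k : Fin n) :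
    fderiv ℝ (fun x => M.location (pairDist x s(i, j))) p (Pi.single (i, k) 1) =
      relPos p i j k / nodeDist p i j ^ M.kappa := by
  rw [fderiv_location_pairDist M h]
  congr 1
  have : ∀ l, relPos (Pi.single (i, k) 1 : V × Fin n → ℝ) i j l = if l = k then 1 else 0 := by
    intro l
    simp [relPos, Pi.single_apply, hij.symm]
  simp [this]

theorem fderiv_location_pairDist_single_of_notMem (M : NoiseModel) {p : V × Fin n → ℝ}
    {e : Sym2 V} (h : 0 < pairDist p e) {i : V} (hi : i ∉ e) (k : Fin n) :
    fderiv ℝ (fun x => M.location (pairDist x e)) p (Pi.single (i, k) 1) = 0 := by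
  induction e with
  | _ a b =>
    rw [fderiv_location_pairDist M h]
    simp only [Sym2.mem_iff, not_or] at hi
    simp [relPos, Ne.symm hi.1, Ne.symm hi.2]

/-- Only the pair `s(i, j)` contains both nodes, and its gradients with respect to them are
opposite; hence a single negative term. -/
theorem sum_jacobian_mul_of_ne {E : Finset (Sym2 V)} (M : NoiseModel) {p : V × Fin n → ℝ}
    (hp : ∀ e ∈ E, 0 < pairDist p e) {i j : V} (hij : i ≠ j) (k l : Fin n) :
    ∑ e : E, rangingJacobian E M p e (i, k) * rangingJacobian E M p e (j, l) =
      if s(i, j) ∈ E then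
        -(relPos p i j k * relPos p i j l / nodeDist p i j ^ (2 * M.kappa)) else 0 := by
  simp only [rangingJacobian, Matrix.of_apply]
  rw [Finset.sum_coe_sort E fun e => fderiv ℝ (fun x => M.location (pairDist x e)) p
    (Pi.single (i, k) 1) * fderiv ℝ (fun x => M.location (pairDist x e)) p (Pi.single (j, l) 1)]
  have h0 : ∀ e ∈ E, e ≠ s(i, j) → fderiv ℝ (fun x => M.location (pairDist x e)) p
      (Pi.single (i, k) 1) * fderiv ℝ (fun x => M.location (pairDist x e)) p
        (Pi.single (j, l) 1) = 0 := by
    intro e he hne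
    by_cases hi : i ∈ e
    · have hj : j ∉ e := fun hj => hne ((Sym2.mem_and_mem_iff hij).1 ⟨hi, hj⟩)
      rw [fderiv_location_pairDist_single_of_notMem M (hp e he) hj, mul_zero]
    · rw [fderiv_location_pairDist_single_of_notMem M (hp e he) hi, zero_mul]
  split_ifs with h
  · rw [Finset.sum_eq_single_of_mem _ h h0, fderiv_location_pairDist_single M hij (hp _ h)]
    have hswap : (s(i, j) : Sym2 V) = s(j, i) := Sym2.eq_swap
    rw [hswap, fderiv_location_pairDist_single M hij.symm (hswap ▸ hp _ h), relPos_swap p i j,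
      nodeDist_swap p i j, two_mul, pow_add]
    ring
  · exact Finset.sum_eq_zero fun e he => h0 e he fun heq => h (heq ▸ he)

/-- Pairs avoiding `i` contribute nothing. As there are no loops, the others correspond to nodes `j
≠ i` through `j ↦ s(i, j)`. -/
theorem sum_jacobian_mul_self {E : Finset (Sym2 V)} (hE : ∀ e ∈ E, ¬ e.IsDiag) (M : NoiseModel)
    {p : V × Fin n → ℝ} (hp : ∀ e ∈ E, 0 < pairDist p e) (i : V) (k l : Fin n) :
    ∑ e : E, rangingJacobian E M p e (i, k) * rangingJacobian E M p e (i, l) =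
      ∑ j ∈ Finset.univ.erase i, if s(i, j) ∈ E then
        relPos p i j k * relPos p i j l / nodeDist p i j ^ (2 * M.kappa) else 0 := by
  simp only [rangingJacobian, Matrix.of_apply]
  rw [Finset.sum_coe_sort E fun e => fderiv ℝ (fun x => M.location (pairDist x e)) p
    (Pi.single (i, k) 1) * fderiv ℝ (fun x => M.location (pairDist x e)) p (Pi.single (i, l) 1)]
  rw [← Finset.sum_filter]
  refine (Finset.sum_of_injOn (fun j => s(i, j)) ?_ ?_ ?_ ?_).symm
  · intro j _ j' _ h
    exact Sym2.congr_right.1 h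
  · intro j hj
    exact (Finset.mem_filter.1 hj).2
  · intro e he hne
    have hi : i ∉ e := by
      intro hi
      obtain ⟨j, rfl⟩ := hi
      refine hne ⟨j, ?_, rfl⟩
      have hij : j ≠ i := fun h => hE _ he (by simp [h])
      simpa [hij] using he
    rw [fderiv_location_pairDist_single_of_notMem M (hp e he) hi, zero_mul]
  · intro j hj
    simp only [Finset.mem_filter, Finset.mem_erase] at hj
    rw [fderiv_location_pairDist_single M hj.1.1.symm (hp _ hj.2),
      fderiv_location_pairDist_single M hj.1.1.symm (hp _ hj.2), two_mul, pow_add]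
    ring

end gram

/-! ### Restriction to the tags. -/

section tags

variable {n : ℕ} {U K : Type*} [DecidableEq U] [DecidableEq K]

/-- The anchor–anchor edges of the graph never meet a tag, so adjacency to a tag is membership in
`E`. -/
theorem networkFIMOffDiag_rangingGraph (E : Finset (Sym2 (U ⊕ K))) (M : NoiseModel)
    (σ : ℝ≥0) (p : (U ⊕ K) × Fin n → ℝ) {u : U} {j : U ⊕ K} (huj : Sum.inl u ≠ j)
    (k l : Fin n) :
    networkFIMOffDiag (rangingGraph E) M σ p (Sum.inl u) j k l =
      ((σ : ℝ) ^ 2)⁻¹ * if s(Sum.inl u, j) ∈ E then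
        -(relPos p (Sum.inl u) j k * relPos p (Sum.inl u) j l /
          nodeDist p (Sum.inl u) j ^ (2 * M.kappa)) else 0 := by
  have hadj : (rangingGraph E).Adj (Sum.inl u) j ↔ s(Sum.inl u, j) ∈ E := by
    simp [rangingGraph, huj]
  unfold networkFIMOffDiag
  by_cases h : s(Sum.inl u, j) ∈ E
  · rw [if_pos (hadj.2 h), if_pos h]
    simp only [Matrix.neg_apply, Matrix.smul_apply, Matrix.vecMulVec_apply, smul_eq_mul,
      one_div, mul_inv]
    ring
  · rw [if_neg (fun h' => h (hadj.1 h')), if_neg h]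
    simp

variable [Fintype U] [Fintype K]

/-- The tag columns of the Jacobian matrix of the location parameters. -/
def tagJacobian (E : Finset (Sym2 (U ⊕ K))) (M : NoiseModel) (p : (U ⊕ K) × Fin n → ℝ) :
    Matrix E (U × Fin n) ℝ :=
  (rangingJacobian E M p).submatrix id fun a => (Sum.inl a.1, a.2)

theorem tagBlock_networkFIM {E : Finset (Sym2 (U ⊕ K))} (hE : ∀ e ∈ E, ¬ e.IsDiag)
    (M : NoiseModel) (σ : ℝ≥0) {p : (U ⊕ K) × Fin n → ℝ} (hp : ∀ e ∈ E, 0 < pairDist p e) :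
    tagBlock (networkFIM (rangingGraph E) M σ p) =
      ((σ : ℝ) ^ 2)⁻¹ • ((tagJacobian E M p)ᵀ * tagJacobian E M p) := by
  ext ⟨u, k⟩ ⟨v, l⟩
  rw [Matrix.smul_apply, Matrix.mul_apply, smul_eq_mul]
  simp only [tagBlock, tagJacobian, Matrix.submatrix_apply, networkFIM, Matrix.of_apply,
    Matrix.transpose_apply, id_eq]
  by_cases huv : u = v
  · subst huv
    rw [if_pos rfl, sum_jacobian_mul_self hE M hp, Matrix.neg_apply, Matrix.sum_apply,
      Finset.mul_sum, ← Finset.sum_neg_distrib]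
    -- The two `erase` sets use different `DecidableEq` instances, the classical one coming from
    -- `networkFIM`.
    refine Finset.sum_congr (by congr; subsingleton) fun j hj => ?_
    rw [networkFIMOffDiag_rangingGraph E M σ p (Finset.ne_of_mem_erase hj).symm]
    split_ifs <;> ring
  · have huv' : (Sum.inl u : U ⊕ K) ≠ Sum.inl v := fun h => huv (Sum.inl_injective h)
    rw [if_neg huv', sum_jacobian_mul_of_ne M hp huv',
      networkFIMOffDiag_rangingGraph E M σ p huv']

theorem tagJacobian_mulVec (E : Finset (Sym2 (U ⊕ K))) (M : NoiseModel)
    (p : (U ⊕ K) × Fin n → ℝ) (w : U × Fin n → ℝ) (e : E) :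
    (tagJacobian E M p *ᵥ w) e =
      fderiv ℝ (fun x => M.location (pairDist x e)) p (configuration w 0) := by
  rw [← rangingJacobian_mulVec]
  simp [Matrix.mulVec, dotProduct, Fintype.sum_prod_type, configuration, tagJacobian]

end tags

/-! ### The information inequality -/

/-- Pull `X` back to the noise space along the observation map at `p`: its mean at `q` becomes the
mean under a translated Gaussian. -/
theorem sq_integral_sub_le_measurementLaw {n : ℕ} {V : Type*} {E : Finset (Sym2 V)}
    (M : NoiseModel) {σ : ℝ≥0} (hσ : 0 < σ) {p q : V × Fin n → ℝ}
    (hp : ∀ e ∈ E, 0 < pairDist p e) (hq : ∀ e ∈ E, 0 < pairDist q e) {X : (E → ℝ) → ℝ}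
    (hXm : Measurable X) (hX : MemLp X 2 (measurementLaw E M σ p)) :
    (∫ y, X y ∂(measurementLaw E M σ q) - ∫ y, X y ∂(measurementLaw E M σ p)) ^ 2 ≤
      variance X (measurementLaw E M σ p) * (Real.exp ((∑ e : E,
        (M.location (pairDist q e) - M.location (pairDist p e)) ^ 2) / (σ : ℝ) ^ 2) - 1) := by
  have hom : ∀ r : V × Fin n → ℝ,
      Measurable fun (w : E → ℝ) (e : E) => M.observe (pairDist r e) (w e) := fun r => by
    have := fun e : E => M.measurable_observe (pairDist r e)
    fun_prop
  unfold measurementLaw at hX ⊢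
  rw [integral_map (hom q).aemeasurable hXm.aestronglyMeasurable,
    integral_map (hom p).aemeasurable hXm.aestronglyMeasurable,
    variance_map hXm.aemeasurable (hom p).aemeasurable]
  rw [memLp_map_measure_iff hXm.aestronglyMeasurable (hom p).aemeasurable] at hX
  have h := sq_integral_shift_sub_le
    (fun e : E => M.location (pairDist q e) - M.location (pairDist p e))
    (pow_ne_zero 2 hσ.ne') (hXm.comp (hom p)) hX
  have h1 : ∀ (w : E → ℝ) (e : E), M.observe (pairDist p e)
      (w e + (M.location (pairDist q e) - M.location (pairDist p e))) =
      M.observe (pairDist q e) (w e) :=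
    fun w e => M.observe_add_location_sub (hp e e.2) (hq e e.2) _
  simpa only [Function.comp_apply, h1, NNReal.coe_pow] using h

/-- The infinitesimal form of a Chapman–Robbins inequality. -/
theorem sq_le_of_eventually_sq_mul_le {ι : Type*} [Fintype ι] {g : ι → ℝ → ℝ} {D : ι → ℝ}
    (hg : ∀ e, HasDerivAt (g e) (D e) 0) {c a s : ℝ} (ha : 0 ≤ a)
    (h : ∀ᶠ t in 𝓝[≠] (0 : ℝ),
      (t * c) ^ 2 ≤ a * (Real.exp ((∑ e, (g e t - g e 0) ^ 2) / s) - 1)) :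
    c ^ 2 ≤ a * ((∑ e, D e ^ 2) / s) := by
  have hslope : Tendsto (fun t : ℝ => (∑ e, (t⁻¹ * (g e t - g e 0)) ^ 2) / s) (𝓝[≠] 0)
      (𝓝 ((∑ e, D e ^ 2) / s)) := by
    refine Tendsto.div_const (tendsto_finsetSum _ fun e _ => Tendsto.pow ?_ 2) s
    have := (hg e).tendsto_slope
    simpa only [slope_fun_def, sub_zero, vsub_eq_sub, smul_eq_mul] using this
  have ht : Tendsto (fun t : ℝ => t ^ 2) (𝓝[≠] 0) (𝓝 0) := by
    have : Tendsto (fun t : ℝ => t ^ 2) (𝓝 0) (𝓝 (0 ^ 2)) := (continuous_pow 2).tendsto 0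
    rw [zero_pow two_ne_zero] at this
    exact this.mono_left nhdsWithin_le_nhds
  have hlim := (hslope.mul (Real.continuous_exp.continuousAt.tendsto.comp
    (ht.mul hslope))).const_mul a
  simp only [zero_mul, Real.exp_zero, mul_one] at hlim
  refine ge_of_tendsto hlim ?_
  filter_upwards [h, self_mem_nhdsWithin] with t hle ht0
  have ht0' : t ≠ 0 := ht0
  have hr : (∑ e, (g e t - g e 0) ^ 2) / s =
      t ^ 2 * ((∑ e, (t⁻¹ * (g e t - g e 0)) ^ 2) / s) := by
    simp only [mul_pow, ← Finset.mul_sum]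
    field_simp
  rw [hr] at hle
  simp only [Function.comp_apply]
  set r := (∑ e, (t⁻¹ * (g e t - g e 0)) ^ 2) / s
  -- This is `1 - u ≤ exp (-u)` times `exp u`, valid for either sign of `u`. The extra factor `exp
  -- (t ^ 2 * r)` tends to 1.
  have hexp : Real.exp (t ^ 2 * r) - 1 ≤ t ^ 2 * r * Real.exp (t ^ 2 * r) := by
    have h1 := Real.add_one_le_exp (-(t ^ 2 * r))
    have h2 := mul_le_mul_of_nonneg_right h1 (Real.exp_pos (t ^ 2 * r)).le
    rw [← Real.exp_add, neg_add_cancel, Real.exp_zero] at h2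
    linarith
  have h3 := hle.trans (mul_le_mul_of_nonneg_left hexp ha)
  have ht2 : 0 < t ^ 2 := by positivity
  refine le_of_mul_le_mul_left ?_ ht2
  linarith

/-- Transposition preserves the first two Penrose equations of a symmetric matrix and exchanges the
last two, so uniqueness applies. -/
theorem moorePenrose_transpose_of_symm {m : Type*} [Fintype m] {F : Matrix m m ℝ}
    (hF : Fᵀ = F) : (moorePenrose F)ᵀ = moorePenrose F := by
  obtain ⟨h1, h2, h3, h4⟩ := isMoorePenroseInverse_moorePenrose F
  refine IsMoorePenroseInverse.unique (A := F) ⟨?_, ?_, ?_, ?_⟩ ⟨h1, h2, h3, h4⟩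
  · conv_rhs => rw [← hF, ← h1]
    simp only [Matrix.transpose_mul, hF, Matrix.mul_assoc]
  · conv_rhs => rw [← h2]
    simp only [Matrix.transpose_mul, hF, Matrix.mul_assoc]
  · rw [Matrix.transpose_mul, Matrix.transpose_transpose, hF, ← h4, Matrix.transpose_mul, hF]
  · rw [Matrix.transpose_mul, Matrix.transpose_transpose, hF, ← h3, Matrix.transpose_mul, hF]

/-- Take `w = F† x`. By `F† F F† = F†` and symmetry, both `x ⬝ w` and `wᵀ F w` equal `xᵀ F† x`, and
one such factor cancels. Invertibility of `F` plays no role. -/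
theorem posSemidef_sub_moorePenrose {m : Type*} [Fintype m] {C F : Matrix m m ℝ}
    (hC : Cᵀ = C) (hF : Fᵀ = F) (hC0 : ∀ x, 0 ≤ x ⬝ᵥ C *ᵥ x)
    (h : ∀ x w, (x ⬝ᵥ w) ^ 2 ≤ (x ⬝ᵥ C *ᵥ x) * (w ⬝ᵥ F *ᵥ w)) :
    (C - moorePenrose F).PosSemidef := by
  have hG := moorePenrose_transpose_of_symm hF
  refine Matrix.PosSemidef.of_dotProduct_mulVec_nonneg ?_ fun x => ?_
  · rw [Matrix.IsHermitian, Matrix.conjTranspose_eq_transpose_of_trivial, Matrix.transpose_sub,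
      hC, hG]
  · have h1 := h x (moorePenrose F *ᵥ x)
    have h2 : (moorePenrose F *ᵥ x) ⬝ᵥ F *ᵥ (moorePenrose F *ᵥ x) = x ⬝ᵥ moorePenrose F *ᵥ x := by
      have h3 : moorePenrose F *ᵥ x = x ᵥ* moorePenrose F := by
        rw [← Matrix.mulVec_transpose, hG]
      conv_lhs => rw [Matrix.mulVec_mulVec]
      conv_lhs => arg 1; rw [h3]
      rw [← Matrix.dotProduct_mulVec, Matrix.mulVec_mulVec, ← Matrix.mul_assoc,
        (isMoorePenroseInverse_moorePenrose F).2.1]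
    rw [h2] at h1
    rw [star_trivial, Matrix.sub_mulVec, dotProduct_sub, sub_nonneg]
    -- If the bound failed, `xᵀ F† x` would be positive, so it could be cancelled in `h1`.
    by_contra! hlt
    have h4 : 0 < x ⬝ᵥ moorePenrose F *ᵥ x := (hC0 x).trans_lt hlt
    nlinarith [mul_lt_mul_of_pos_right hlt h4]

theorem covarianceMatrix_quadratic {Y κ : Type*} [MeasurableSpace Y] [Fintype κ]
    {T : Y → κ → ℝ} {P : Measure Y} [IsProbabilityMeasure P] (hTm : Measurable T)
    (hT : ∀ a, MemLp (fun y => T y a) 2 P) (x : κ → ℝ) :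
    x ⬝ᵥ covarianceMatrix T P *ᵥ x = variance (fun y => ∑ a, x a * T y a) P := by
  have hXm : AEMeasurable (fun y => ∑ a, x a * T y a) P := by fun_prop
  rw [← covariance_self hXm, covariance_fun_sum_fun_sum (fun a => (hT a).const_mul (x a))
    (fun a => (hT a).const_mul (x a))]
  simp only [dotProduct, Matrix.mulVec, covarianceMatrix, Matrix.of_apply, Finset.mul_sum,
    covariance_const_mul_left, covariance_const_mul_right]
  refine Finset.sum_congr rfl fun a _ => Finset.sum_congr rfl fun b _ => ?_
  ring

theorem HasMean.integral_sum_mul {Y κ : Type*} [MeasurableSpace Y] [Fintype κ]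
    {T : Y → κ → ℝ} {P : Measure Y} {q : κ → ℝ} (h : HasMean T P q) (x : κ → ℝ) :
    ∫ y, ∑ a, x a * T y a ∂P = x ⬝ᵥ q := by
  rw [integral_finsetSum _ fun a _ => (h a).1.const_mul (x a)]
  simp only [integral_const_mul, (h _).2, dotProduct]

theorem isProbabilityMeasure_measurementLaw {n : ℕ} {V : Type*} (E : Finset (Sym2 V))
    (M : NoiseModel) (σ : ℝ≥0) (p : V × Fin n → ℝ) :
    IsProbabilityMeasure (measurementLaw E M σ p) := by
  have := fun e : E => M.measurable_observe (pairDist p e)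
  refine Measure.isProbabilityMeasure_map ?_
  exact (by fun_prop : Measurable fun (w : E → ℝ) (e : E) =>
    M.observe (pairDist p e) (w e)).aemeasurable

/-! ### The Cramér–Rao bound along lines in the space of tag positions. -/

section cramerRao

variable {n : ℕ} {U K : Type*}

theorem configuration_add_smul (p w : U × Fin n → ℝ) (pK : K × Fin n → ℝ) (t : ℝ) :
    configuration (p + t • w) pK = configuration p pK + t • configuration w 0 := by
  funext ⟨i, k⟩
  cases i <;> simp [configuration]

variable [Fintype U] [Fintype K] [DecidableEq U] [DecidableEq K]

theorem sq_dotProduct_le_variance_mul {E : Finset (Sym2 (U ⊕ K))} (M : NoiseModel) {σ : ℝ≥0}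
    (hσ : 0 < σ) {pU : U × Fin n → ℝ} {pK : K × Fin n → ℝ}
    (hp : ∀ e ∈ E, 0 < pairDist (configuration pU pK) e) {T : (E → ℝ) → (U × Fin n → ℝ)}
    (hTm : Measurable T)
    (hT : ∀ᶠ q in 𝓝 pU, HasMean T (measurementLaw E M σ (configuration q pK)) q)
    (hT2 : ∀ a, MemLp (fun y => T y a) 2 (measurementLaw E M σ (configuration pU pK)))
    (x w : U × Fin n → ℝ) :
    (x ⬝ᵥ w) ^ 2 ≤
      variance (fun y => ∑ a, x a * T y a) (measurementLaw E M σ (configuration pU pK)) *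
        ((∑ e, (tagJacobian E M (configuration pU pK) *ᵥ w) e ^ 2) / (σ : ℝ) ^ 2) := by
  refine sq_le_of_eventually_sq_mul_le (g := fun (e : E) (t : ℝ) => M.location
    (pairDist (configuration pU pK + t • configuration w 0) e)) (fun e => ?_)
    (variance_nonneg _ _) ?_
  · rw [tagJacobian_mulVec]
    have h1 := (contDiffAt_location_pairDist M (hp e e.2) (k := 1)).differentiableAt (by simp)
    exact h1.hasFDerivAt.hasLineDerivAt _
  -- For small `t`, unbiasedness and positivity of the distances both hold at `pU + t • w`.
  · have hline : Tendsto (fun t : ℝ => pU + t • w) (𝓝[≠] 0) (𝓝 pU) := by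
      have : Continuous fun t : ℝ => pU + t • w := by fun_prop
      have h0 := this.tendsto 0
      rw [zero_smul, add_zero] at h0
      exact h0.mono_left nhdsWithin_le_nhds
    have hpos : ∀ᶠ t in 𝓝[≠] (0 : ℝ), ∀ e : E,
        0 < pairDist (configuration (pU + t • w) pK) e := by
      refine eventually_all.2 fun e => ?_
      have hc : Continuous fun t : ℝ => pairDist (configuration (pU + t • w) pK) e := by
        simp only [configuration_add_smul]
        exact (continuous_pairDist _).comp (by fun_prop)
      have h0 := hc.tendsto 0
      rw [zero_smul, add_zero] at h0
      exact (h0.mono_left nhdsWithin_le_nhds).eventually (lt_mem_nhds (hp e e.2))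
    filter_upwards [hline.eventually hT, hpos] with t hmean ht
    have h := sq_integral_sub_le_measurementLaw M hσ hp (fun e he => ht ⟨e, he⟩)
      (X := fun y => ∑ a, x a * T y a) (by fun_prop)
      (memLp_finsetSum _ fun a _ => (hT2 a).const_mul (x a))
    -- Unbiasedness at both positions makes the difference of the means equal to `t * (x ⬝ᵥ w)`.
    rw [hmean.integral_sum_mul, hT.self_of_nhds.integral_sum_mul, dotProduct_add,
      add_sub_cancel_left, dotProduct_smul, smul_eq_mul] at h
    simpa only [configuration_add_smul, zero_smul, add_zero] using h

theorem posSemidef_covarianceMatrix_sub {E : Finset (Sym2 (U ⊕ K))} (M : NoiseModel) {σ : ℝ≥0}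
    (hσ : 0 < σ) {pU : U × Fin n → ℝ} {pK : K × Fin n → ℝ}
    (hp : ∀ e ∈ E, 0 < pairDist (configuration pU pK) e) {T : (E → ℝ) → (U × Fin n → ℝ)}
    (hTm : Measurable T)
    (hT : ∀ᶠ q in 𝓝 pU, HasMean T (measurementLaw E M σ (configuration q pK)) q)
    (hT2 : ∀ a, MemLp (fun y => T y a) 2 (measurementLaw E M σ (configuration pU pK))) :
    (covarianceMatrix T (measurementLaw E M σ (configuration pU pK)) - moorePenrose
      (((σ : ℝ) ^ 2)⁻¹ • ((tagJacobian E M (configuration pU pK))ᵀ *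
        tagJacobian E M (configuration pU pK)))).PosSemidef := by
  have := isProbabilityMeasure_measurementLaw E M σ (configuration pU pK)
  refine posSemidef_sub_moorePenrose ?_ ?_ (fun x => ?_) fun x w => ?_
  · ext a b
    exact covariance_comm _ _
  · simp [Matrix.transpose_mul]
  · rw [covarianceMatrix_quadratic hTm hT2]
    exact variance_nonneg _ _
  · rw [covarianceMatrix_quadratic hTm hT2]
    refine (sq_dotProduct_le_variance_mul M hσ hp hTm hT hT2 x w).trans_eq ?_
    congr 1
    rw [Matrix.smul_mulVec, dotProduct_smul, ← Matrix.mulVec_mulVec, Matrix.dotProduct_mulVec,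
      Matrix.vecMul_transpose, smul_eq_mul, div_eq_inv_mul]
    simp only [dotProduct, pow_two]

end cramerRao

end

theorem mainTheorem4 {n : ℕ} {U K : Type*} [Fintype U] [Fintype K]
    [DecidableEq U] [DecidableEq K]
    (E : Finset (Sym2 (U ⊕ K)))
    (hE : ∀ e ∈ E, ¬ e.IsDiag ∧ ∃ u : U, Sum.inl u ∈ e)
    (M : NoiseModel) (σ : ℝ≥0) (hσ : 0 < σ)
    (pU : U × Fin n → ℝ) (pK : K × Fin n → ℝ)
    (hdist : ∀ e ∈ E, 0 < pairDist (configuration pU pK) e) :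
    tagBlock (fisherInformation (measurementDensity E M σ) (configuration pU pK)) =
        tagBlock (networkFIM (rangingGraph E) M σ (configuration pU pK)) ∧
      ∀ T : (E → ℝ) → (U × Fin n → ℝ), Measurable T →
        (∀ᶠ q in 𝓝 pU, HasMean T (measurementLaw E M σ (configuration q pK)) q) →
        (∀ a, MemLp (fun y => T y a) 2 (measurementLaw E M σ (configuration pU pK))) →
        (covarianceMatrix T (measurementLaw E M σ (configuration pU pK)) -
          moorePenrose
            (tagBlock (networkFIM (rangingGraph E) M σ (configuration pU pK)))).PosSemidef := by
  rw [tagBlock_networkFIM (fun e he => (hE e he).1) M σ hdist]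
  refine ⟨?_, fun T hTm hT hT2 => posSemidef_covarianceMatrix_sub M hσ hdist hTm hT hT2⟩
  rw [fisherInformation_measurementDensity M hσ hdist]
  -- The tag block of `JᵀJ` is by definition the Gram matrix of the tag columns of `J`.
  rfl
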